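/- **Setting.** Let $\Theta \subset \mathbb{R}^d$ be a measurable set contained in a ball of radius $R$, and let $\ell_1, \ell_2, \dots : \Theta \to [0,1]$ be a (possibly random) sequence of loss functions fixed before the interaction with the learner begins. A function on $\Theta$ is *piecewise $L$-Lipschitz* if $\Theta$ can be partitioned into at most countably many regions on each of which it is $L$-Lipschitz. For $f : \mathbb{N} \times [0,\infty) \to \mathbb{R}$ the losses are *$f$-dispersed* for the Lipschitz constant $L$ if for all $T$ and all $\epsilon > 0$ $$\mathbb{E}\Bigl[\max_{\rho \in \Theta} \bigl|\{1 \le t \le T : \ell_t \text{ is not } L\text{-Lipschitz on } B(\rho,\epsilon) \cap \Theta\}\bigr|\Bigr] \le f(T,\epsilon).$$ They have an *$r_0$-interior minimizer* if, with probability one, for every $T$ there is $\rho^* \in \operatorname{argmin}_{\rho\in\Theta} \sum_{t=1}^T \ell_t(\rho)$ with $B(\rho^*, r_0) \subset \Theta$. On each round $t$ there is a feedback system, i.e. a partition $A^{(t)}_1, \dots, A^{(t)}_M$ of $\Theta$ into $M$ (measurable) sets, also fixed (possibly at random) before the interaction and not revealed to the learner in advance; $A^{(t)}(\rho)$ denotes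 the set that contains $\rho$. A learner that plays $\rho_t$ observes the set $A^{(t)}(\rho_t)$ and the loss $\ell_t(\rho)$ for all $\rho \in A^{(t)}(\rho_t)$. **Algorithm (continuous Exp3-SET with step size $\lambda$).** Put $w_1(\rho) = 1$ for all $\rho \in \Theta$. On round $t = 1, \dots, T$: let $p_t(\rho) = w_t(\rho) / \int_\Theta w_t$ and, given the past plays, the losses and the feedback systems, sample $\rho_t \in \Theta$ from the density $p_t$; put $$\hat\ell_t(\rho) = \frac{\mathbf{1}[\rho \in A^{(t)}(\rho_t)]}{p_t(A^{(t)}(\rho_t))}\, \ell_t(\rho), \qquad p_t(S) = \int_{S} p_t(\rho)\,d\rho, \qquad w_{t+1}(\rho) = w_t(\rho)\, e^{-\lambda \hat\ell_t(\rho)} .$$ **Theorem.** There is a universal constant $C > 0$ such that the following holds. Suppose that $\Theta$ is contained in a ball of radius $R$ and that the losses $\ell_1, \ell_2, \dots : \Theta \to [0,1]$ are piecewise $L$-Lipschitz with $L \ge 0$, $f$-dispersed for the Lipschitz constant $L$, and have an $r_0$-interior minimizer, and that every feedback system has $M$ sets. Then for every $T \ge 1$ and every $r \in (0, r_0]$,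 running continuous Exp3-SET for $T$ rounds with $\lambda = \sqrt{d \log(R/r)/(TM)}$ satisfies, for every minimizer $\rho^* \in \operatorname{argmin}_{\rho\in\Theta} \sum_{t=1}^T \ell_t(\rho)$, $$\mathbb{E}\Bigl[\sum_{t=1}^T \bigl(\ell_t(\rho_t) - \ell_t(\rho^*)\bigr)\Bigr] \le C\Bigl(\sqrt{d\,T M \log(R/r)} + f(T,r) + T L r\Bigr),$$ where the expectation is over the losses, the feedback systems and the algorithm's randomness. -/

import Mathlib

open MeasureTheory ProbabilityTheory
open scoped NNReal ENNReal

namespace Exp3Set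

noncomputable section

/-- The Euclidean space that contains the parameter space. -/
abbrev Param (d : ℕ) := EuclideanSpace ℝ (Fin d)

/-- `g` is piecewise `L`-Lipschitz on `Θ`: there is a partition of `Θ` into (at most countably many)
regions on each of which `g` is `L`-Lipschitz. Some of the listed regions may be empty, so finite
partitions are included. -/
def PiecewiseLipschitz {d : ℕ} (L : ℝ≥0) (Θ : Set (Param d)) (g : Param d → ℝ) : Prop :=
  ∃ C : ℕ → Set (Param d), Pairwise (fun i j => Disjoint (C i) (C j)) ∧ (⋃ i, C i) = Θ ∧
    ∀ i, LipschitzOnWith L g (C i)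

/-- The number of losses among the first `T` that are not `L`-Lipschitz on the ball of radius `ε`
around `x` (losses are functions on `Θ`, so the ball is taken in `Θ`). -/
def nonLipschitzCount {d : ℕ} (L : ℝ≥0) (Θ : Set (Param d)) (ℓ : ℕ → Param d → ℝ)
    (T : ℕ) (ε : ℝ) (x : Param d) : ℕ :=
  Set.ncard {t : ℕ | t < T ∧ ¬ LipschitzOnWith L (ℓ t) (Metric.ball x ε ∩ Θ)}

/-- The random sequence of losses is `f`-dispersed for the Lipschitz constant `L`: for all `T` and
all `ε > 0`, the expectation of the maximum over `x ∈ Θ` of the number of losses among the first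
`T` that are not `L`-Lipschitz on the `ε`-ball around `x` is at most `f T ε`. (The expectation is
that of a function with values in `[0, T]`, so `toReal` is applied to a finite number.) -/
def Dispersed {d : ℕ} {Ω : Type*} [MeasurableSpace Ω] (P : Measure Ω) (L : ℝ≥0)
    (Θ : Set (Param d)) (ℓ : ℕ → Ω → Param d → ℝ) (f : ℕ → ℝ → ℝ) : Prop :=
  ∀ (T : ℕ) (ε : ℝ), 0 < ε →
    (∫⁻ ω, ⨆ x ∈ Θ, (nonLipschitzCount L Θ (fun t => ℓ t ω) T ε x : ℝ≥0∞) ∂P).toReal ≤ f T ε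

/-- `x` minimizes over `Θ` the total of the first `T` losses. -/
def IsBestInHindsight {d : ℕ} (Θ : Set (Param d)) (ℓ : ℕ → Param d → ℝ) (T : ℕ)
    (x : Param d) : Prop :=
  x ∈ Θ ∧ ∀ y ∈ Θ, ∑ t ∈ Finset.range T, ℓ t x ≤ ∑ t ∈ Finset.range T, ℓ t y

/-- The random sequence of losses has an `r₀`-interior minimizer: with probability one, for every
`T` some minimizer of the total of the first `T` losses is the centre of an `r₀`-ball that lies
in `Θ`. -/
def HasInteriorMinimizer {d : ℕ} {Ω : Type*} [MeasurableSpace Ω] (P : Measure Ω)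
    (Θ : Set (Param d)) (ℓ : ℕ → Ω → Param d → ℝ) (r₀ : ℝ) : Prop :=
  ∀ᵐ ω ∂P, ∀ T : ℕ, ∃ x, IsBestInHindsight Θ (fun t => ℓ t ω) T x ∧ Metric.ball x r₀ ⊆ Θ

/-- A feedback system: a partition of `Θ` into `M` sets. -/
def IsFeedbackSystem {d M : ℕ} (Θ : Set (Param d)) (A : Fin M → Set (Param d)) : Prop :=
  Pairwise (fun i j => Disjoint (A i) (A j)) ∧ (⋃ i, A i) = Θ

/-- The set of the feedback system that contains `ρ`. -/
def feedbackSet {d M : ℕ} (A : Fin M → Set (Param d)) (ρ : Param d) : Set (Param d) :=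
  {x | ∃ i, ρ ∈ A i ∧ x ∈ A i}

/-- The density `p(x) = w(x) / ∫_Θ w` on `Θ` that belongs to the weight function `w`. -/
def density {d : ℕ} (Θ : Set (Param d)) (w : Param d → ℝ) (x : Param d) : ℝ :=
  w x / ∫ y in Θ, w y

/-- The probability `p(S) = ∫_S p` of a set `S ⊆ Θ`. -/
def setProb {d : ℕ} (Θ : Set (Param d)) (w : Param d → ℝ) (S : Set (Param d)) : ℝ :=
  ∫ x in S, density Θ w x

/-- The importance-weighted estimate of the loss `g` after `ρ` was drawn from the density
of `w` and the loss was observed on the feedback set `A(ρ)`: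
`x ↦ 1[x ∈ A(ρ)] g(x) / p(A(ρ))`. -/
def lossEstimate {d M : ℕ} (Θ : Set (Param d)) (w g : Param d → ℝ) (A : Fin M → Set (Param d))
    (ρ x : Param d) : ℝ :=
  (feedbackSet A ρ).indicator g x / setProb Θ w (feedbackSet A ρ)

/-- The weights of continuous Exp3-SET with step size `lam` after `t` rounds in which the parameters
`h 0, …, h (t - 1)` were played. Rounds are numbered from `0`. -/
def weight {d M : ℕ} (lam : ℝ) (Θ : Set (Param d)) (ℓ : ℕ → Param d → ℝ)
    (A : ℕ → Fin M → Set (Param d)) : (t : ℕ) → (Fin t → Param d) → Param d → ℝ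
  | 0, _, _ => 1
  | t + 1, h, x =>
      weight lam Θ ℓ A t (Fin.init h) x *
        Real.exp (-lam *
          lossEstimate Θ (weight lam Θ ℓ A t (Fin.init h)) (ℓ t) (A t) (h (Fin.last t)) x)

/-- The law of the parameter played in round `t`, given the outcome `ω` of the adversary's
randomness and the parameters `h` played so far: the distribution on `Θ` with density `p_t`. -/
def playKernel {d M : ℕ} {Ω : Type*} [MeasurableSpace Ω] (lam : ℝ) (Θ : Set (Param d))
    (ℓ : ℕ → Ω → Param d → ℝ) (A : ℕ → Ω → Fin M → Set (Param d)) (t : ℕ) :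
    Kernel (Ω × (Fin t → Param d)) (Param d) :=
  (Kernel.const (Ω × (Fin t → Param d)) (volume.restrict Θ)).withDensity fun q x =>
    ENNReal.ofReal (density Θ (weight lam Θ (fun s => ℓ s q.1) (fun s => A s q.1) t q.2) x)

/-- The joint law of the adversary's randomness `ω` (drawn from `P` before the interaction) and
the parameters played in the first `t` rounds by continuous Exp3-SET with step size `lam`. -/
def runLaw {d M : ℕ} {Ω : Type*} [MeasurableSpace Ω] (P : Measure Ω) (lam : ℝ)
    (Θ : Set (Param d)) (ℓ : ℕ → Ω → Param d → ℝ) (A : ℕ → Ω → Fin M → Set (Param d)) :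
    (t : ℕ) → Measure (Ω × (Fin t → Param d))
  | 0 => P.map fun ω => (ω, Fin.elim0)
  | t + 1 => ((runLaw P lam Θ ℓ A t).compProd (playKernel lam Θ ℓ A t)).map
      fun q => (q.1.1, Fin.snoc q.1.2 q.2)

end

end Exp3Set

/-! Since losses and feedback systems are fixed before play, the argument runs for one outcome `ω`
at a time, and the comparison ball `B` of radius `r` around an interior minimizer may depend on `ω`.
The learner competes with the average loss over `B` instead of the loss at a single point, which has
zero mass under a density.

The carrier is `potential`: the log of the normalised total weight minus the average log-weight on
`B`. It starts at 0. By Jensen it never falls below `-log (vol Θ / vol B)` (`le_potential`), and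
this is at least `-d log (R/r)` (`log_volume_ratio_le`). In one round, `exp (-y) ≤ 1 - y + y²/2`
bounds the change of the log total weight by first and second moments of the loss estimate. In
expectation over the play the first moment is the learner's expected loss. A cell of probability `q`
has second moment at most `1/q` and is hit with probability `q`, so the `M` cells contribute at most
`M` in total. This is `integral_loss_add_potential_le`: expected loss plus scaled potential grows by
at most `λM/2` plus the average loss on `B`.

Telescoping (`integral_histKernel_le`) gives `K/λ + TλM/2` with `K = d log (R/r)`, and the chosen
`λ` turns this into `3/2 * √(KTM)`. Finally, a loss that is Lipschitz on `B` has average within `Lr`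
of its value at the centre; every other loss costs at most 1, and dispersion bounds their expected
number (`average_ball_le`). -/

namespace Exp3Set

/-! ### Measurability of the weights and Markov property of the play kernel -/

section Weights

variable {d M : ℕ} {Θ : Set (Param d)} {Ω : Type*} [MeasurableSpace Ω]

lemma feedbackSet_eq {A : Fin M → Set (Param d)} (hA : IsFeedbackSystem Θ A) {i : Fin M}
    {ρ : Param d} (hρ : ρ ∈ A i) : feedbackSet A ρ = A i := by
  ext x
  constructor
  · rintro ⟨j, hj, hx⟩
    by_cases hij : i = j
    · exact hij ▸ hx
    · exact absurd hj (Set.disjoint_left.1 (hA.1 hij) hρ)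
  · exact fun hx => ⟨i, hρ, hx⟩

lemma subset_of_isFeedbackSystem {A : Fin M → Set (Param d)} (hA : IsFeedbackSystem Θ A)
    (i : Fin M) : A i ⊆ Θ :=
  hA.2 ▸ Set.subset_iUnion A i

lemma feedbackSet_subset {A : Fin M → Set (Param d)} (hA : IsFeedbackSystem Θ A) (ρ : Param d) :
    feedbackSet A ρ ⊆ Θ := by
  rintro x ⟨i, -, hx⟩
  exact subset_of_isFeedbackSystem hA i hx

lemma measurableSet_feedbackSet {β : Type*} [MeasurableSpace β] {A : β → Fin M → Set (Param d)}
    (hA : ∀ i, MeasurableSet {q : β × Param d | q.2 ∈ A q.1 i}) {g : β → Param d}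
    (hg : Measurable g) :
    MeasurableSet {q : β × Param d | q.2 ∈ feedbackSet (A q.1) (g q.1)} := by
  have : {q : β × Param d | q.2 ∈ feedbackSet (A q.1) (g q.1)} =
      ⋃ i, {q : β × Param d | g q.1 ∈ A q.1 i} ∩ {q : β × Param d | q.2 ∈ A q.1 i} := by
    ext q
    simp [feedbackSet]
  rw [this]
  refine MeasurableSet.iUnion fun i => MeasurableSet.inter ?_ (hA i)
  have h : Measurable fun q : β × Param d => (q.1, g q.1) := by fun_prop
  exact h (hA i)

lemma measurable_density {β : Type*} [MeasurableSpace β] {w : β → Param d → ℝ}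
    (hw : Measurable fun q : β × Param d => w q.1 q.2) :
    Measurable fun q : β × Param d => density Θ (w q.1) q.2 := by
  have h1 : Measurable fun b : β => ∫ y in Θ, w b y :=
    (hw.stronglyMeasurable.integral_prod_right' (ν := volume.restrict Θ)).measurable
  exact hw.div (h1.comp measurable_fst)

lemma measurable_lossEstimate {β : Type*} [MeasurableSpace β] {w g : β → Param d → ℝ}
    {A : β → Fin M → Set (Param d)} {ρ : β → Param d}
    (hw : Measurable fun q : β × Param d => w q.1 q.2)
    (hg : Measurable fun q : β × Param d => g q.1 q.2)
    (hA : ∀ i, MeasurableSet {q : β × Param d | q.2 ∈ A q.1 i}) (hρ : Measurable ρ) :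
    Measurable fun q : β × Param d => lossEstimate Θ (w q.1) (g q.1) (A q.1) (ρ q.1) q.2 := by
  have hF := measurableSet_feedbackSet hA hρ
  have h1 : Measurable fun q : β × Param d =>
      (feedbackSet (A q.1) (ρ q.1)).indicator (g q.1) q.2 := hg.indicator hF
  have h2 : Measurable fun b : β => setProb Θ (w b) (feedbackSet (A b) (ρ b)) := by
    have h3 : Measurable fun q : β × Param d =>
        (feedbackSet (A q.1) (ρ q.1)).indicator (density Θ (w q.1)) q.2 :=
      (measurable_density (Θ := Θ) hw).indicator hF
    have h4 := (h3.stronglyMeasurable.integral_prod_right' (ν := volume)).measurable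
    convert h4 using 1
    funext b
    have : MeasurableSet (feedbackSet (A b) (ρ b)) := measurable_prodMk_left (x := b) hF
    simp [setProb, integral_indicator this]
  exact h1.div (h2.comp measurable_fst)

lemma measurable_init (t : ℕ) :
    Measurable fun h : Fin (t + 1) → Param d => (Fin.init h : Fin t → Param d) :=
  measurable_pi_lambda _ fun i => measurable_pi_apply i.castSucc

lemma measurable_weight (lam : ℝ) {ℓ : ℕ → Ω → Param d → ℝ}
    {A : ℕ → Ω → Fin M → Set (Param d)}
    (hℓ : ∀ t, Measurable fun q : Ω × Param d => ℓ t q.1 q.2)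
    (hA : ∀ t i, MeasurableSet {q : Ω × Param d | q.2 ∈ A t q.1 i}) (t : ℕ) :
    Measurable fun q : (Ω × (Fin t → Param d)) × Param d =>
      weight lam Θ (fun s => ℓ s q.1.1) (fun s => A s q.1.1) t q.1.2 q.2 := by
  induction t with
  | zero => simp only [weight]; exact measurable_const
  | succ t ih =>
    simp only [weight]
    have hw : Measurable fun q : (Ω × (Fin (t + 1) → Param d)) × Param d =>
        weight lam Θ (fun s => ℓ s q.1.1) (fun s => A s q.1.1) t (Fin.init q.1.2) q.2 := by
      have : Measurable fun q : (Ω × (Fin (t + 1) → Param d)) × Param d =>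
          (((q.1.1, Fin.init q.1.2), q.2) : (Ω × (Fin t → Param d)) × Param d) :=
        (Measurable.prodMk (by fun_prop)
          ((measurable_init t).comp (measurable_snd.comp measurable_fst))).prodMk measurable_snd
      exact ih.comp this
    have hfst : Measurable fun q : (Ω × (Fin (t + 1) → Param d)) × Param d => (q.1.1, q.2) := by
      fun_prop
    have hE := measurable_lossEstimate (Θ := Θ) (β := Ω × (Fin (t + 1) → Param d))
      (w := fun b => weight lam Θ (fun s => ℓ s b.1) (fun s => A s b.1) t (Fin.init b.2))
      (g := fun b => ℓ t b.1) (A := fun b => A t b.1) (ρ := fun b => b.2 (Fin.last t)) hw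
      ((hℓ t).comp hfst) (fun i => hfst (hA t i)) (by fun_prop)
    exact hw.mul (hE.const_mul (-lam)).exp

/-- `w` is measurable, at most one and bounded away from zero. -/
structure IsWeight (w : Param d → ℝ) : Prop where
  measurable : Measurable w
  le_one : ∀ x, w x ≤ 1
  exists_le : ∃ c, 0 < c ∧ ∀ x, c ≤ w x

lemma IsWeight.pos {w : Param d → ℝ} (hw : IsWeight w) (x : Param d) : 0 < w x := by
  obtain ⟨c, hc, h⟩ := hw.exists_le
  exact hc.trans_le (h x)

lemma IsWeight.integrable {w : Param d → ℝ} (hw : IsWeight w) (μ : Measure (Param d))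
    [IsFiniteMeasure μ] : Integrable w μ :=
  Integrable.of_bound hw.measurable.aestronglyMeasurable 1
    (ae_of_all _ fun x => by rw [Real.norm_eq_abs, abs_of_pos (hw.pos x)]; exact hw.le_one x)

lemma IsWeight.integral_pos {w : Param d → ℝ} (hw : IsWeight w) (μ : Measure (Param d))
    [IsFiniteMeasure μ] [NeZero μ] : 0 < ∫ x, w x ∂μ := by
  rw [integral_pos_iff_support_of_nonneg (fun x => (hw.pos x).le) (hw.integrable μ)]
  have : Function.support w = Set.univ := by
    ext x
    simp [(hw.pos x).ne']
  rw [this]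
  exact NeZero.pos _

lemma IsWeight.density_nonneg {w : Param d → ℝ} (hw : IsWeight w) (x : Param d) :
    0 ≤ density Θ w x :=
  div_nonneg (hw.pos x).le (integral_nonneg fun y => (hw.pos y).le)

lemma IsWeight.setProb_nonneg {w : Param d → ℝ} (hw : IsWeight w) (S : Set (Param d)) :
    0 ≤ setProb Θ w S :=
  integral_nonneg fun _ => hw.density_nonneg _

lemma lossEstimate_mem {w g : Param d → ℝ} (hw : IsWeight w) {A : Fin M → Set (Param d)}
    (hA : IsFeedbackSystem Θ A) (hg : ∀ x ∈ Θ, g x ∈ Set.Icc (0 : ℝ) 1) (ρ x : Param d) :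
    lossEstimate Θ w g A ρ x ∈ Set.Icc 0 (1 / setProb Θ w (feedbackSet A ρ)) := by
  have hS := hw.setProb_nonneg (Θ := Θ) (feedbackSet A ρ)
  unfold lossEstimate
  by_cases hx : x ∈ feedbackSet A ρ
  · have := hg x (feedbackSet_subset hA ρ hx)
    rw [Set.indicator_of_mem hx]
    exact ⟨div_nonneg this.1 hS, div_le_div_of_nonneg_right this.2 hS⟩
  · rw [Set.indicator_of_notMem hx, zero_div]
    exact ⟨le_rfl, by positivity⟩

/-- The positive lower bound survives because the estimate is bounded by the inverse probability of
the observed cell. The new bound depends on `ρ`, so it is not uniform over histories; integrability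
of the log-weights needs it only for each fixed history. -/
lemma isWeight_update {w g : Param d → ℝ} (hw : IsWeight w) {A : Fin M → Set (Param d)}
    (hA : IsFeedbackSystem Θ A) (hAm : ∀ i, MeasurableSet (A i)) (hgm : Measurable g)
    (hg : ∀ x ∈ Θ, g x ∈ Set.Icc (0 : ℝ) 1) {lam : ℝ} (hlam : 0 ≤ lam) (ρ : Param d) :
    IsWeight fun x => w x * Real.exp (-lam * lossEstimate Θ w g A ρ x) := by
  refine ⟨?_, fun x => ?_, ?_⟩
  · have hF : MeasurableSet (feedbackSet A ρ) := by
      have : feedbackSet A ρ = ⋃ i, ⋃ _ : ρ ∈ A i, A i := by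
        ext x
        simp [feedbackSet]
      rw [this]
      exact MeasurableSet.iUnion fun i => MeasurableSet.iUnion fun _ => hAm i
    unfold lossEstimate
    exact hw.measurable.mul ((((hgm.indicator hF).div_const _).const_mul _).exp)
  · have h := (lossEstimate_mem hw hA hg ρ x).1
    have : Real.exp (-lam * lossEstimate Θ w g A ρ x) ≤ 1 :=
      Real.exp_le_one_iff.2 (by nlinarith)
    exact mul_le_one₀ (hw.le_one x) (Real.exp_pos _).le this
  · obtain ⟨c, hc, h⟩ := hw.exists_le
    refine ⟨c * Real.exp (-lam * (1 / setProb Θ w (feedbackSet A ρ))), by positivity,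
      fun x => ?_⟩
    have h' := (lossEstimate_mem hw hA hg ρ x).2
    refine mul_le_mul (h x) (Real.exp_le_exp.2 ?_) (Real.exp_pos _).le (hw.pos x).le
    nlinarith

lemma isWeight_weight {lam : ℝ} (hlam : 0 ≤ lam) {ℓ : ℕ → Param d → ℝ}
    {A : ℕ → Fin M → Set (Param d)} (hℓm : ∀ t, Measurable (ℓ t))
    (hℓ : ∀ t, ∀ x ∈ Θ, ℓ t x ∈ Set.Icc (0 : ℝ) 1) (hA : ∀ t, IsFeedbackSystem Θ (A t))
    (hAm : ∀ t i, MeasurableSet (A t i)) (t : ℕ) (h : Fin t → Param d) :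
    IsWeight (weight lam Θ ℓ A t h) := by
  induction t with
  | zero => exact ⟨measurable_const, fun _ => le_rfl, 1, one_pos, fun _ => le_rfl⟩
  | succ t ih => exact isWeight_update (ih _) (hA t) (hAm t) (hℓm t) (hℓ t) hlam _

/-- The distribution on `Θ` with the density of `w`. -/
noncomputable def playMeasure (Θ : Set (Param d)) (w : Param d → ℝ) : Measure (Param d) :=
  (volume.restrict Θ).withDensity fun x => ENNReal.ofReal (density Θ w x)

lemma isProbabilityMeasure_playMeasure {w : Param d → ℝ} (hw : IsWeight w)
    [IsFiniteMeasure (volume.restrict Θ)] [NeZero (volume.restrict Θ)] :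
    IsProbabilityMeasure (playMeasure Θ w) := by
  constructor
  have hpos := hw.integral_pos (volume.restrict Θ)
  have hint : Integrable (density Θ w) (volume.restrict Θ) :=
    (hw.integrable (volume.restrict Θ)).div_const _
  rw [playMeasure, withDensity_apply _ MeasurableSet.univ, Measure.restrict_univ,
    ← ofReal_integral_eq_lintegral_ofReal hint (ae_of_all _ fun x => hw.density_nonneg x)]
  simp only [density]
  rw [integral_div, div_self hpos.ne', ENNReal.ofReal_one]

lemma playKernel_apply (lam : ℝ) {ℓ : ℕ → Ω → Param d → ℝ}
    {A : ℕ → Ω → Fin M → Set (Param d)}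
    (hℓ : ∀ t, Measurable fun q : Ω × Param d => ℓ t q.1 q.2)
    (hA : ∀ t i, MeasurableSet {q : Ω × Param d | q.2 ∈ A t q.1 i}) (t : ℕ)
    (q : Ω × (Fin t → Param d)) :
    playKernel lam Θ ℓ A t q =
      playMeasure Θ (weight lam Θ (fun s => ℓ s q.1) (fun s => A s q.1) t q.2) := by
  rw [playKernel, Kernel.withDensity_apply]
  · rfl
  · exact (measurable_density (Θ := Θ)
      (w := fun q : Ω × (Fin t → Param d) =>
        weight lam Θ (fun s => ℓ s q.1) (fun s => A s q.1) t q.2)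
      (measurable_weight lam hℓ hA t)).ennreal_ofReal

lemma isMarkovKernel_playKernel {lam : ℝ} (hlam : 0 ≤ lam) {ℓ : ℕ → Ω → Param d → ℝ}
    {A : ℕ → Ω → Fin M → Set (Param d)}
    (hℓm : ∀ t, Measurable fun q : Ω × Param d => ℓ t q.1 q.2)
    (hℓ : ∀ t ω, ∀ x ∈ Θ, ℓ t ω x ∈ Set.Icc (0 : ℝ) 1)
    (hA : ∀ t ω, IsFeedbackSystem Θ (A t ω))
    (hAm : ∀ t i, MeasurableSet {q : Ω × Param d | q.2 ∈ A t q.1 i})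
    [IsFiniteMeasure (volume.restrict Θ)] [NeZero (volume.restrict Θ)] (t : ℕ) :
    IsMarkovKernel (playKernel lam Θ ℓ A t) := by
  refine ⟨fun q => ?_⟩
  rw [playKernel_apply lam hℓm hAm]
  exact isProbabilityMeasure_playMeasure (isWeight_weight hlam
    (fun t => (hℓm t).of_uncurry_left) (fun t => hℓ t _) (fun t => hA t _)
    (fun t i => measurable_prodMk_left (hAm t i)) t q.2)

end Weights

/-! ### One round: the drift of the potential -/

section OneRound

variable {d M : ℕ} {Θ B : Set (Param d)}

/-- Follows from `1 + y + y²/2 ≤ exp y`, since `(1 - y + y²/2)(1 + y + y²/2) = 1 + y⁴/4 ≥ 1`. -/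
lemma exp_neg_le_quadratic {y : ℝ} (hy : 0 ≤ y) : Real.exp (-y) ≤ 1 - y + y ^ 2 / 2 := by
  have h1 := Real.quadratic_le_exp_of_nonneg hy
  have h2 : Real.exp (-y) * Real.exp y = 1 := by rw [← Real.exp_add]; simp
  have h3 : 0 ≤ 1 - y + y ^ 2 / 2 := by nlinarith [sq_nonneg (y - 1)]
  have h4 : 1 ≤ (1 - y + y ^ 2 / 2) * (1 + y + y ^ 2 / 2) := by nlinarith [sq_nonneg (y ^ 2)]
  have h5 : Real.exp (-y) * Real.exp y ≤ (1 - y + y ^ 2 / 2) * Real.exp y := by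
    rw [h2]
    exact h4.trans (mul_le_mul_of_nonneg_left h1 h3)
  exact le_of_mul_le_mul_right h5 (Real.exp_pos y)

/-- The quadratic bound is integrated and `log z ≤ z - 1` applied. Because `φ ≥ 0`, no upper limit
on `lam * φ` is needed; this matters as importance-weighted estimates can be arbitrarily large. `K`
serves integrability only. -/
lemma log_integral_exp_neg_le {α : Type*} [MeasurableSpace α] (p : Measure α)
    [IsProbabilityMeasure p] {φ : α → ℝ} {K lam : ℝ} (hφm : Measurable φ)
    (hφ : ∀ x, φ x ∈ Set.Icc 0 K) (hlam : 0 ≤ lam) :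
    Real.log (∫ x, Real.exp (-lam * φ x) ∂p) ≤
      -lam * ∫ x, φ x ∂p + lam ^ 2 / 2 * ∫ x, φ x ^ 2 ∂p := by
  have hφi : Integrable φ p := Integrable.of_bound hφm.aestronglyMeasurable K
    (ae_of_all _ fun x => by rw [Real.norm_eq_abs, abs_of_nonneg (hφ x).1]; exact (hφ x).2)
  have hφ2 : Integrable (fun x => φ x ^ 2) p :=
    Integrable.of_bound (hφm.pow_const 2).aestronglyMeasurable (K ^ 2)
      (ae_of_all _ fun x => by
        rw [Real.norm_eq_abs, abs_of_nonneg (sq_nonneg _)]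
        exact pow_le_pow_left₀ (hφ x).1 (hφ x).2 2)
  have hexp : Integrable (fun x => Real.exp (-lam * φ x)) p :=
    Integrable.of_bound ((hφm.const_mul _).exp).aestronglyMeasurable 1
      (ae_of_all _ fun x => by
        rw [Real.norm_eq_abs, abs_of_pos (Real.exp_pos _)]
        exact Real.exp_le_one_iff.2 (by nlinarith [(hφ x).1]))
  have hle : ∫ x, Real.exp (-lam * φ x) ∂p ≤
      ∫ x, (1 + (-lam * φ x + lam ^ 2 / 2 * φ x ^ 2)) ∂p := by
    refine integral_mono hexp ((integrable_const _).add
      ((hφi.const_mul _).add (hφ2.const_mul _))) fun x => ?_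
    have := exp_neg_le_quadratic (mul_nonneg hlam (hφ x).1)
    simp only [neg_mul]
    linarith [mul_pow lam (φ x) 2]
  have hsplit : ∫ x, (1 + (-lam * φ x + lam ^ 2 / 2 * φ x ^ 2)) ∂p =
      (∫ _, (1 : ℝ) ∂p) + (-lam * (∫ x, φ x ∂p) + lam ^ 2 / 2 * ∫ x, φ x ^ 2 ∂p) := by
    rw [← integral_const_mul, ← integral_const_mul,
      ← integral_add (hφi.const_mul _) (hφ2.const_mul _)]
    exact integral_add (integrable_const _) ((hφi.const_mul _).add (hφ2.const_mul _))
  rw [hsplit] at hle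
  have hpos : 0 < ∫ x, Real.exp (-lam * φ x) ∂p := integral_exp_pos hexp
  have := Real.log_le_sub_one_of_pos hpos
  simp only [integral_const, probReal_univ, smul_eq_mul, mul_one] at hle
  linarith

lemma integral_playMeasure {w : Param d → ℝ} (hw : IsWeight w) (f : Param d → ℝ) :
    ∫ x, f x ∂playMeasure Θ w = ∫ x in Θ, density Θ w x * f x := by
  have hm : Measurable (density Θ w) := hw.measurable.div_const _
  rw [playMeasure, integral_withDensity_eq_integral_toReal_smul hm.ennreal_ofReal
    (ae_of_all _ fun _ => ENNReal.ofReal_lt_top)]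
  simp only [ENNReal.toReal_ofReal (hw.density_nonneg _), smul_eq_mul]

lemma setProb_eq {w : Param d → ℝ} (hw : IsWeight w) {S : Set (Param d)} (hS : MeasurableSet S)
    (hSΘ : S ⊆ Θ) : setProb Θ w S = (playMeasure Θ w).real S := by
  have h := integral_playMeasure (Θ := Θ) hw (S.indicator 1)
  rw [integral_indicator_one hS] at h
  rw [h, setProb]
  have : ∀ x, density Θ w x * S.indicator (1 : Param d → ℝ) x =
      S.indicator (density Θ w) x := fun x => by
    by_cases hx : x ∈ S <;> simp [hx]
  simp only [this]
  rw [integral_indicator hS, Measure.restrict_restrict hS, Set.inter_eq_left.2 hSΘ]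

lemma ae_mem_playMeasure (hΘ : MeasurableSet Θ) (w : Param d → ℝ) :
    ∀ᵐ x ∂playMeasure Θ w, x ∈ Θ :=
  (withDensity_absolutelyContinuous _ _).ae_le (ae_restrict_mem hΘ)

/-- The logarithm of the normalised total weight, relative to the average log-weight on `B`. -/
noncomputable def potential (Θ B : Set (Param d)) (w : Param d → ℝ) : ℝ :=
  Real.log ((∫ x in Θ, w x) / volume.real Θ) - ⨍ x in B, Real.log (w x)

lemma IsWeight.integrable_log {w : Param d → ℝ} (hw : IsWeight w) (μ : Measure (Param d))
    [IsFiniteMeasure μ] : Integrable (fun x => Real.log (w x)) μ := by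
  obtain ⟨c, hc, h⟩ := hw.exists_le
  refine Integrable.of_bound hw.measurable.log.aestronglyMeasurable (-Real.log c)
    (ae_of_all _ fun x => ?_)
  rw [Real.norm_eq_abs, abs_of_nonpos (Real.log_nonpos (hw.pos x).le (hw.le_one x))]
  exact neg_le_neg (Real.log_le_log hc (h x))

/-- Jensen for `log` on `B`, together with `∫_B w ≤ ∫_Θ w`. The constant is the price of competing
with the uniform distribution on `B` from the uniform prior on `Θ`. -/
lemma le_potential {w : Param d → ℝ} (hw : IsWeight w) (hBΘ : B ⊆ Θ)
    (hB : volume B ≠ 0) (hΘ : volume Θ ≠ ∞) :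
    -Real.log (volume.real Θ / volume.real B) ≤ potential Θ B w := by
  have hB' : volume B ≠ ∞ := ((measure_mono hBΘ).trans_lt hΘ.lt_top).ne
  have hvB : 0 < volume.real B := ENNReal.toReal_pos hB hB'
  have hvΘ : 0 < volume.real Θ := hvB.trans_le (measureReal_mono hBΘ hΘ)
  have : IsFiniteMeasure (volume.restrict Θ) := ⟨by simpa using hΘ.lt_top⟩
  have : IsFiniteMeasure (volume.restrict B) := ⟨by simpa using hB'.lt_top⟩
  have : NeZero (volume.restrict B) := ⟨by simpa using hB⟩
  obtain ⟨c, hc, h⟩ := hw.exists_le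
  have hjensen : ⨍ x in B, Real.log (w x) ≤ Real.log (⨍ x in B, w x) := by
    -- Jensen requires a closed set on which `log` is continuous, which is why weights are bounded
    -- away from zero.
    refine ConcaveOn.le_map_average (s := Set.Ici c)
      (strictConcaveOn_log_Ioi.concaveOn.subset (fun x hx => hc.trans_le hx) (convex_Ici c))
      (Real.continuousOn_log.mono fun x hx => (hc.trans_le hx).ne') isClosed_Ici
      (ae_of_all _ h) (hw.integrable _) (hw.integrable_log _)
  have hBpos := hw.integral_pos (volume.restrict B)
  have hle : ∫ x in B, w x ≤ ∫ x in Θ, w x :=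
    setIntegral_mono_set (hw.integrable _) (ae_of_all _ fun x => (hw.pos x).le)
      hBΘ.eventuallyLE
  have hlog : Real.log (∫ x in B, w x) ≤ Real.log (∫ x in Θ, w x) := Real.log_le_log hBpos hle
  rw [setAverage_eq, smul_eq_mul, setAverage_eq, smul_eq_mul,
    Real.log_mul (inv_ne_zero hvB.ne') hBpos.ne', Real.log_inv] at hjensen
  rw [potential, Real.log_div (hBpos.trans_le hle).ne' hvΘ.ne', Real.log_div hvΘ.ne' hvB.ne',
    setAverage_eq, smul_eq_mul]
  linarith

/-- The factor `p(A i)` is the probability that cell `i` is observed. It cancels the importance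
weights, so summing over `i` yields the expected drift. -/
lemma potential_update_le {w g : Param d → ℝ} (hw : IsWeight w) {A : Fin M → Set (Param d)}
    (hA : IsFeedbackSystem Θ A) (hAm : ∀ i, MeasurableSet (A i)) (hgm : Measurable g)
    (hg : ∀ x ∈ Θ, g x ∈ Set.Icc (0 : ℝ) 1) {lam : ℝ} (hlam : 0 ≤ lam)
    (hBΘ : B ⊆ Θ) (hB : volume B ≠ 0) (hΘ : volume Θ ≠ ∞) {i : Fin M} {ρ : Param d}
    (hρ : ρ ∈ A i) :
    (playMeasure Θ w).real (A i) *
        potential Θ B (fun x => w x * Real.exp (-lam * lossEstimate Θ w g A ρ x)) ≤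
      (playMeasure Θ w).real (A i) * potential Θ B w
        - lam * (∫ x in A i, g x ∂playMeasure Θ w) + lam ^ 2 / 2
        + lam * ⨍ x in B, (A i).indicator g x := by
  have hB' : volume B ≠ ∞ := ((measure_mono hBΘ).trans_lt hΘ.lt_top).ne
  have hvB : 0 < volume.real B := ENNReal.toReal_pos hB hB'
  have hvΘ : 0 < volume.real Θ := hvB.trans_le (measureReal_mono hBΘ hΘ)
  have : IsFiniteMeasure (volume.restrict Θ) := ⟨by simpa using hΘ.lt_top⟩
  have : NeZero (volume.restrict Θ) :=
    ⟨by simpa using fun h => hB (measure_mono_null hBΘ h)⟩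
  have : IsFiniteMeasure (volume.restrict B) := ⟨by simpa using hB'.lt_top⟩
  have : NeZero (volume.restrict B) := ⟨by simpa using hB⟩
  have := isProbabilityMeasure_playMeasure (Θ := Θ) hw
  have hAΘ := subset_of_isFeedbackSystem hA i
  have hset : setProb Θ w (feedbackSet A ρ) = (playMeasure Θ w).real (A i) := by
    rw [feedbackSet_eq hA hρ, setProb_eq hw (hAm i) hAΘ]
  have hest : ∀ x, lossEstimate Θ w g A ρ x =
      (A i).indicator g x / (playMeasure Θ w).real (A i) := fun x => by
    rw [lossEstimate, hset, feedbackSet_eq hA hρ]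
  have hmem := lossEstimate_mem hw hA hg ρ
  rw [hset] at hmem
  have hind : ∀ x, (A i).indicator g x ∈ Set.Icc (0 : ℝ) 1 := fun x => by
    by_cases hx : x ∈ A i
    · simpa [hx] using hg x (hAΘ hx)
    · simp [hx]
  have havg : 0 ≤ ⨍ x in B, (A i).indicator g x := by
    rw [setAverage_eq]
    exact smul_nonneg (by positivity) (integral_nonneg fun x => (hind x).1)
  set p := playMeasure Θ w with hp
  set q := p.real (A i) with hq
  set φ := fun x => lossEstimate Θ w g A ρ x with hφ
  have hφm : Measurable φ := by
    have : φ = fun x => (A i).indicator g x / q := funext hest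
    rw [this]
    exact (hgm.indicator (hAm i)).div_const _
  have hqn : 0 ≤ q := measureReal_nonneg
  -- For a cell of probability zero every term carrying `p` vanishes and the remaining ones are
  -- nonnegative.
  rcases hqn.eq_or_lt with hq0 | hqpos
  · have h0 : ∫ x in A i, g x ∂p = 0 := by
      have : p (A i) = 0 := (measureReal_eq_zero_iff).1 hq0.symm
      rw [Measure.restrict_eq_zero.2 this, integral_zero_measure]
    rw [← hq0, h0]
    have := mul_nonneg hlam havg
    nlinarith [sq_nonneg lam]
  · have hW := hw.integral_pos (volume.restrict Θ)
    have hw' : IsWeight fun x => w x * Real.exp (-lam * φ x) :=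
      isWeight_update hw hA hAm hgm hg hlam ρ
    have hW' := hw'.integral_pos (volume.restrict Θ)
    have hratio : (∫ x in Θ, w x * Real.exp (-lam * φ x)) / ∫ x in Θ, w x =
        ∫ x, Real.exp (-lam * φ x) ∂p := by
      rw [hp, integral_playMeasure hw, ← integral_div]
      refine integral_congr_ae (ae_of_all _ fun x => ?_)
      simp only [density]
      ring
    have hlog := log_integral_exp_neg_le p hφm hmem hlam
    rw [← hratio, Real.log_div hW'.ne' hW.ne'] at hlog
    have hint1 : ∫ x, φ x ∂p = (∫ x in A i, g x ∂p) / q := by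
      rw [← integral_indicator (hAm i), ← integral_div]
      exact integral_congr_ae (ae_of_all _ hest)
    -- The estimate vanishes off the cell and is at most `1 / q` on it, so its second moment is at
    -- most `q · 1/q²`.
    have hint2 : ∫ x, φ x ^ 2 ∂p ≤ 1 / q := by
      have h1 : ∫ x, φ x ^ 2 ∂p ≤ ∫ x, (A i).indicator (fun _ => 1 / q ^ 2) x ∂p := by
        refine integral_mono_of_nonneg (ae_of_all _ fun x => sq_nonneg _)
          ((integrable_const _).indicator (hAm i)) (ae_of_all _ fun x => ?_)
        simp only
        by_cases hx : x ∈ A i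
        · rw [Set.indicator_of_mem hx, ← one_div_pow]
          exact pow_le_pow_left₀ (hmem x).1 (hmem x).2 2
        · simp [hφ, hest, hx]
      refine h1.trans_eq ?_
      rw [integral_indicator_const _ (hAm i), smul_eq_mul, ← hq]
      field_simp
    have hlogavg : ⨍ x in B, Real.log (w x * Real.exp (-lam * φ x)) =
        (⨍ x in B, Real.log (w x)) - lam * ((⨍ x in B, (A i).indicator g x) / q) := by
      have h1 : ∀ x, Real.log (w x * Real.exp (-lam * φ x)) =
          Real.log (w x) - lam / q * (A i).indicator g x := fun x => by
        rw [Real.log_mul (hw.pos x).ne' (Real.exp_pos _).ne', Real.log_exp]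
        simp only [hφ, hest]
        ring
      have h2 : Integrable (fun x => lam / q * (A i).indicator g x) (volume.restrict B) :=
        (Integrable.of_bound (hgm.indicator (hAm i)).aestronglyMeasurable 1
          (ae_of_all _ fun x => by
            rw [Real.norm_eq_abs, abs_of_nonneg (hind x).1]; exact (hind x).2)).const_mul _
      simp only [h1]
      rw [setAverage_eq, integral_sub (hw.integrable_log _) h2, integral_const_mul,
        setAverage_eq, setAverage_eq]
      simp only [smul_eq_mul]
      ring
    rw [potential, potential, hlogavg, Real.log_div hW'.ne' hvΘ.ne', Real.log_div hW.ne' hvΘ.ne']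
    rw [hint1] at hlog
    have hfin : lam ^ 2 / 2 * ∫ x, φ x ^ 2 ∂p ≤ lam ^ 2 / 2 * (1 / q) :=
      mul_le_mul_of_nonneg_left hint2 (by positivity)
    have key := mul_le_mul_of_nonneg_left (hlog.trans (add_le_add_right hfin _)) hqpos.le
    have e1 : q * (-lam * ((∫ x in A i, g x ∂p) / q) + lam ^ 2 / 2 * (1 / q)) =
        -lam * (∫ x in A i, g x ∂p) + lam ^ 2 / 2 := by field_simp
    have e2 : q * (lam * ((⨍ x in B, (A i).indicator g x) / q)) =
        lam * ⨍ x in B, (A i).indicator g x := by field_simp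
    rw [e1] at key
    linarith [key, e2]

/-- The updated potential depends on the play only through the observed cell. Its expectation is
therefore a finite sum, and integrability comes without a separate measurability proof. -/
lemma integral_of_eq_on_partition {p : Measure (Param d)} [IsFiniteMeasure p]
    {A : Fin M → Set (Param d)} (hA : IsFeedbackSystem Θ A) (hAm : ∀ i, MeasurableSet (A i))
    (hp : ∀ᵐ x ∂p, x ∈ Θ) {Φ : Param d → ℝ} {F : Fin M → ℝ} (hΦ : ∀ i, ∀ x ∈ A i, Φ x = F i) :
    Integrable Φ p ∧ ∫ x, Φ x ∂p = ∑ i, p.real (A i) * F i := by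
  have hae : Φ =ᵐ[p] fun x => ∑ i, (A i).indicator (fun _ => F i) x := by
    filter_upwards [hp] with x hx
    rw [← hA.2] at hx
    obtain ⟨i, hi⟩ := Set.mem_iUnion.1 hx
    rw [Finset.sum_eq_single i, Set.indicator_of_mem hi, hΦ i x hi]
    · intro j _ hji
      exact Set.indicator_of_notMem (Set.disjoint_left.1 (hA.1 hji.symm) hi) _
    · simp
  have hint : ∀ i ∈ Finset.univ, Integrable ((A i).indicator fun _ => F i) p := fun i _ =>
    (integrable_const (F i)).indicator (hAm i)
  refine ⟨(integrable_finsetSum _ hint).congr hae.symm, ?_⟩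
  rw [integral_congr_ae hae, integral_finsetSum _ hint]
  refine Finset.sum_congr rfl fun i _ => ?_
  rw [integral_indicator_const _ (hAm i), smul_eq_mul]

lemma sum_integral_partition {p : Measure (Param d)} {A : Fin M → Set (Param d)}
    (hA : IsFeedbackSystem Θ A) (hAm : ∀ i, MeasurableSet (A i)) (hp : ∀ᵐ x ∂p, x ∈ Θ)
    {g : Param d → ℝ} (hg : Integrable g p) :
    ∑ i, ∫ x in A i, g x ∂p = ∫ x, g x ∂p := by
  rw [← integral_iUnion_fintype hAm hA.1 fun i => hg.integrableOn, hA.2,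
    Measure.restrict_eq_self_of_ae_mem hp]

/-- The expected loss of a round plus the expected potential after it. -/
lemma integral_loss_add_potential_le {w g : Param d → ℝ} (hw : IsWeight w)
    {A : Fin M → Set (Param d)} (hA : IsFeedbackSystem Θ A) (hAm : ∀ i, MeasurableSet (A i))
    (hgm : Measurable g) (hg : ∀ x ∈ Θ, g x ∈ Set.Icc (0 : ℝ) 1) {lam : ℝ} (hlam : 0 < lam)
    (hBm : MeasurableSet B) (hBΘ : B ⊆ Θ) (hB : volume B ≠ 0) (hΘm : MeasurableSet Θ)
    (hΘ : volume Θ ≠ ∞) :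
    Integrable (fun ρ => g ρ +
        potential Θ B (fun x => w x * Real.exp (-lam * lossEstimate Θ w g A ρ x)) / lam)
        (playMeasure Θ w) ∧
      ∫ ρ, (g ρ +
        potential Θ B (fun x => w x * Real.exp (-lam * lossEstimate Θ w g A ρ x)) / lam)
        ∂playMeasure Θ w ≤ potential Θ B w / lam + (lam * M / 2 + ⨍ x in B, g x) := by
  have : IsFiniteMeasure (volume.restrict Θ) := ⟨by simpa using hΘ.lt_top⟩
  have : NeZero (volume.restrict Θ) :=
    ⟨by simpa using fun h => hB (measure_mono_null hBΘ h)⟩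
  have : IsFiniteMeasure (volume.restrict B) :=
    ⟨by simpa using (measure_mono hBΘ).trans_lt hΘ.lt_top⟩
  have := isProbabilityMeasure_playMeasure (Θ := Θ) hw
  have hmem := ae_mem_playMeasure hΘm w
  have hnorm : ∀ x ∈ Θ, ‖g x‖ ≤ 1 := fun x hx => by
    rw [Real.norm_eq_abs, abs_of_nonneg (hg x hx).1]; exact (hg x hx).2
  have hgi : Integrable g (playMeasure Θ w) :=
    Integrable.of_bound hgm.aestronglyMeasurable 1 (hmem.mono hnorm)
  have hmemB : ∀ᵐ x ∂volume.restrict B, x ∈ Θ := (ae_restrict_mem hBm).mono fun x hx => hBΘ hx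
  have hgB : Integrable g (volume.restrict B) :=
    Integrable.of_bound hgm.aestronglyMeasurable 1 (hmemB.mono hnorm)
  have hex : ∀ i, ∃ F : ℝ, (∀ ρ ∈ A i,
      potential Θ B (fun x => w x * Real.exp (-lam * lossEstimate Θ w g A ρ x)) = F) ∧
      (playMeasure Θ w).real (A i) * F ≤ (playMeasure Θ w).real (A i) * potential Θ B w
        - lam * (∫ x in A i, g x ∂playMeasure Θ w) + lam ^ 2 / 2
        + lam * ⨍ x in B, (A i).indicator g x := by
    intro i
    rcases (A i).eq_empty_or_nonempty with he | ⟨ρ, hρ⟩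
    · refine ⟨0, by simp [he], ?_⟩
      simp [he, average_eq]
      positivity
    · refine ⟨_, fun ρ' hρ' => ?_, potential_update_le hw hA hAm hgm hg hlam.le hBΘ hB hΘ hρ⟩
      simp only [lossEstimate, feedbackSet_eq hA hρ, feedbackSet_eq hA hρ']
  choose F hF hFle using hex
  obtain ⟨hi, heq⟩ := integral_of_eq_on_partition hA hAm hmem hF
  refine ⟨hgi.add (hi.div_const _), ?_⟩
  rw [integral_add hgi (hi.div_const _), integral_div, heq]
  have hsum := Finset.sum_le_sum fun i (_ : i ∈ Finset.univ) => hFle i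
  have hone : ∑ i, (playMeasure Θ w).real (A i) = 1 := by
    have := (integral_of_eq_on_partition hA hAm hmem (Φ := fun _ => 1) (F := fun _ => 1)
      fun _ _ _ => rfl).2
    simpa using this.symm
  have havg : ∑ i, ⨍ x in B, (A i).indicator g x = ⨍ x in B, g x := by
    rw [setAverage_eq, ← sum_integral_partition hA hAm hmemB hgB, Finset.smul_sum]
    refine Finset.sum_congr rfl fun i _ => ?_
    rw [setAverage_eq, integral_indicator (hAm i)]
  simp only [Finset.sum_add_distrib, Finset.sum_sub_distrib, ← Finset.sum_mul, ← Finset.mul_sum,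
    hone, havg, sum_integral_partition hA hAm hmem hgi, Finset.sum_const, Finset.card_univ,
    Fintype.card_fin, nsmul_eq_mul, one_mul] at hsum
  have h2 := div_le_div_of_nonneg_right hsum hlam.le
  have h3 : (potential Θ B w - lam * (∫ x, g x ∂playMeasure Θ w) + M * (lam ^ 2 / 2) +
      lam * ⨍ x in B, g x) / lam = potential Θ B w / lam - (∫ x, g x ∂playMeasure Θ w) +
        lam * M / 2 + ⨍ x in B, g x := by
    field_simp
  rw [h3] at h2
  linarith

end OneRound

/-! ### The law of the plays given the adversary's randomness -/

section History

variable {d : ℕ} {Θ : Set (Param d)} {Ω : Type*} [MeasurableSpace Ω]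

/-- The conditional law of the first `t` plays, when the play of round `s` has the conditional law
`κ s` given the adversary's randomness and the plays before. -/
noncomputable def histKernel (κ : ∀ t, Kernel (Ω × (Fin t → Param d)) (Param d)) :
    (t : ℕ) → Kernel Ω (Fin t → Param d)
  | 0 => Kernel.const Ω (Measure.dirac Fin.elim0)
  | t + 1 => (histKernel κ t ⊗ₖ κ t).map fun q => Fin.snoc q.1 q.2

lemma measurable_snoc (t : ℕ) : Measurable fun q : (Fin t → Param d) × Param d =>
    (Fin.snoc q.1 q.2 : Fin (t + 1) → Param d) := by
  refine measurable_pi_lambda _ fun i => ?_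
  refine Fin.lastCases ?_ (fun j => ?_) i
  · simpa using measurable_snd
  · simp only [Fin.snoc_castSucc]
    exact (measurable_pi_apply j).comp measurable_fst

lemma ae_mem_histKernel (κ : ∀ t, Kernel (Ω × (Fin t → Param d)) (Param d))
    (hΘ : MeasurableSet Θ) (hκ : ∀ t q, ∀ᵐ x ∂κ t q, x ∈ Θ) (t : ℕ) (ω : Ω) :
    ∀ᵐ h ∂histKernel κ t ω, ∀ i, h i ∈ Θ := by
  have hmeas : ∀ t : ℕ, MeasurableSet {h : Fin t → Param d | ∀ i, h i ∈ Θ} := fun t => by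
    simp only [Set.ofPred_forall]
    exact MeasurableSet.iInter fun i => measurable_pi_apply i hΘ
  induction t with
  | zero => exact ae_of_all _ fun h i => i.elim0
  | succ t ih =>
    rw [histKernel, Kernel.map_apply _ (measurable_snoc t),
      ae_map_iff (measurable_snoc t).aemeasurable (hmeas _)]
    refine Kernel.ae_compProd_of_ae_ae (measurable_snoc t (hmeas _)) ?_
    filter_upwards [ih] with h hh
    filter_upwards [hκ t (ω, h)] with ρ hρ i
    refine Fin.lastCases ?_ (fun j => ?_) i
    · simpa using hρ
    · simpa using hh j

variable (κ : ∀ t, Kernel (Ω × (Fin t → Param d)) (Param d)) [∀ t, IsMarkovKernel (κ t)]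

instance isMarkovKernel_histKernel (t : ℕ) : IsMarkovKernel (histKernel κ t) := by
  induction t with
  | zero => rw [histKernel]; infer_instance
  | succ t ih => rw [histKernel]; exact Kernel.IsMarkovKernel.map _ (measurable_snoc t)

/-- Disintegration over the adversary's randomness: it permits the regret analysis at fixed `ω`. -/
lemma runLaw_eq_compProd {M : ℕ} (P : Measure Ω) [IsProbabilityMeasure P] (lam : ℝ)
    (ℓ : ℕ → Ω → Param d → ℝ) (A : ℕ → Ω → Fin M → Set (Param d))
    [∀ t, IsMarkovKernel (playKernel lam Θ ℓ A t)] (t : ℕ) :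
    runLaw P lam Θ ℓ A t = P ⊗ₘ histKernel (playKernel lam Θ ℓ A) t := by
  induction t with
  | zero =>
    rw [runLaw, histKernel, Measure.compProd_const, Measure.prod_dirac]
  | succ t ih =>
    rw [runLaw, histKernel, ih, Measure.compProd_map (measurable_snoc t),
      ← Measure.compProd_assoc, Measure.map_map _ (by fun_prop)]
    · rfl
    · exact Measurable.prodMk (measurable_fst.comp measurable_fst) ((measurable_snoc t).comp
        ((measurable_snd.comp measurable_fst).prodMk measurable_snd))

/-- `G` need not be measurable: a measurable minorant with the same lower integral gives the one
inequality required. Hence joint measurability of the potential in the history never has to be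
shown. -/
lemma lintegral_histKernel_succ_le (t : ℕ) (ω : Ω) (G : (Fin (t + 1) → Param d) → ℝ≥0∞) :
    ∫⁻ h, G h ∂histKernel κ (t + 1) ω ≤
      ∫⁻ h, ∫⁻ ρ, G (Fin.snoc h ρ) ∂κ t (ω, h) ∂histKernel κ t ω := by
  obtain ⟨G', hG'm, hG'le, hG'eq⟩ := exists_measurable_le_lintegral_eq (histKernel κ (t + 1) ω) G
  rw [hG'eq, histKernel, Kernel.lintegral_map _ (measurable_snoc t) _ hG'm]
  refine (Kernel.lintegral_compProd _ _ _ (hG'm.comp (measurable_snoc t))).trans_le ?_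
  exact lintegral_mono fun h => lintegral_mono fun ρ => hG'le _

variable {κ}

/-- A potential that falls in expectation by at least the loss minus `b t` in each round bounds the
expected total loss. -/
lemma integral_histKernel_le (hΘ : MeasurableSet Θ) (hκ : ∀ t q, ∀ᵐ x ∂κ t q, x ∈ Θ) (ω : Ω)
    {g : ℕ → Param d → ℝ} (hgm : ∀ t, Measurable (g t))
    (hg : ∀ t, ∀ x ∈ Θ, g t x ∈ Set.Icc (0 : ℝ) 1) {D : (t : ℕ) → (Fin t → Param d) → ℝ}
    {k : ℝ} {b : ℕ → ℝ} (hb : ∀ t, 0 ≤ b t) (hD0 : ∀ h, D 0 h ≤ 0) (hD : ∀ t h, -k ≤ D t h)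
    (hstep : ∀ t h, Integrable (fun ρ => g t ρ + D (t + 1) (Fin.snoc h ρ)) (κ t (ω, h)) ∧
      ∫ ρ, (g t ρ + D (t + 1) (Fin.snoc h ρ)) ∂κ t (ω, h) ≤ D t h + b t) (T : ℕ) :
    ∫ h, ∑ i : Fin T, g i (h i) ∂histKernel κ T ω ≤ k + ∑ t ∈ Finset.range T, b t := by
  have hk : 0 ≤ k := by linarith [hD 0 Fin.elim0, hD0 Fin.elim0]
  have hnonneg : ∀ n, ∀ᵐ h ∂histKernel κ n ω, 0 ≤ ∑ i : Fin n, g i (h i) := fun n =>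
    (ae_mem_histKernel κ hΘ hκ n ω).mono fun h hh =>
      Finset.sum_nonneg fun i _ => (hg _ _ (hh i)).1
  -- Adding `k` makes the integrand nonnegative on histories in `Θ`, so the induction can use lower
  -- integrals.
  have hmain : ∀ n, ∫⁻ h, ENNReal.ofReal (∑ i : Fin n, g i (h i) + D n h + k) ∂histKernel κ n ω ≤
      ENNReal.ofReal (k + ∑ t ∈ Finset.range n, b t) := by
    intro n
    induction n with
    | zero =>
      refine (lintegral_mono (g := fun _ => ENNReal.ofReal k) fun h =>
        ENNReal.ofReal_le_ofReal ?_).trans_eq (by simp)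
      simpa using hD0 h
    | succ n ih =>
      refine (lintegral_histKernel_succ_le κ n ω _).trans ?_
      have hin : ∀ᵐ h ∂histKernel κ n ω,
          ∫⁻ ρ, ENNReal.ofReal (∑ i : Fin (n + 1), g i ((Fin.snoc h ρ : Fin (n + 1) → Param d) i)
            + D (n + 1) (Fin.snoc h ρ) + k) ∂κ n (ω, h) ≤
          ENNReal.ofReal (∑ i : Fin n, g i (h i) + D n h + k) + ENNReal.ofReal (b n) := by
        filter_upwards [hnonneg n] with h hh
        obtain ⟨hi, hle⟩ := hstep n h
        have hrw : ∀ ρ, ∑ i : Fin (n + 1), g i ((Fin.snoc h ρ : Fin (n + 1) → Param d) i)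
            + D (n + 1) (Fin.snoc h ρ) + k =
            (g n ρ + D (n + 1) (Fin.snoc h ρ)) + (∑ i : Fin n, g i (h i) + k) := fun ρ => by
          rw [Fin.sum_univ_castSucc]
          simp only [Fin.snoc_castSucc, Fin.snoc_last, Fin.val_castSucc, Fin.val_last]
          ring
        simp only [hrw]
        have hadd : Integrable (fun ρ => (g n ρ + D (n + 1) (Fin.snoc h ρ)) +
            (∑ i : Fin n, g i (h i) + k)) (κ n (ω, h)) := hi.add (integrable_const _)
        rw [← ofReal_integral_eq_lintegral_ofReal hadd, integral_add hi (integrable_const _), integral_const, probReal_univ, one_smul,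
          ← ENNReal.ofReal_add (by linarith [hD n h]) (hb n)]
        · exact ENNReal.ofReal_le_ofReal (by linarith)
        · filter_upwards [hκ n (ω, h)] with ρ hρ
          have := (hg n ρ hρ).1
          have := hD (n + 1) (Fin.snoc h ρ)
          simp only [Pi.zero_apply]
          linarith
      refine (lintegral_mono_ae hin).trans ?_
      rw [lintegral_add_right _ measurable_const, lintegral_const, measure_univ, mul_one,
        Finset.sum_range_succ, ← add_assoc, ENNReal.ofReal_add
          (add_nonneg hk (Finset.sum_nonneg fun t _ => hb t)) (hb n)]
      gcongr
  have hint : Integrable (fun h : Fin T → Param d => ∑ i : Fin T, g i (h i))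
      (histKernel κ T ω) := by
    refine integrable_finsetSum _ fun i _ => Integrable.of_bound
      ((hgm i).comp (measurable_pi_apply i)).aestronglyMeasurable 1 ?_
    filter_upwards [ae_mem_histKernel κ hΘ hκ T ω] with h hh
    rw [Real.norm_eq_abs, abs_of_nonneg (hg _ _ (hh i)).1]
    exact (hg _ _ (hh i)).2
  rw [← ENNReal.ofReal_le_ofReal_iff (add_nonneg hk (Finset.sum_nonneg fun t _ => hb t)),
    ofReal_integral_eq_lintegral_ofReal hint (hnonneg T)]
  refine (lintegral_mono fun h => ENNReal.ofReal_le_ofReal ?_).trans (hmain T)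
  linarith [hD T h]

end History

/-! ### The regret given the adversary's randomness -/

section Regret

variable {d M : ℕ} {Θ B : Set (Param d)} {Ω : Type*} [MeasurableSpace Ω]

lemma weight_zero_step (ℓ : ℕ → Param d → ℝ) (A : ℕ → Fin M → Set (Param d)) (t : ℕ)
    (h : Fin t → Param d) (x : Param d) : weight 0 Θ ℓ A t h x = 1 := by
  induction t with
  | zero => rfl
  | succ t ih => simp [weight, ih]

/-- Serves the degenerate step size 0: there `B` and `Θ` agree up to a null set, and uniform play on
`Θ` is uniform play on `B`. -/
lemma integral_playMeasure_one_eq (hBm : MeasurableSet B) (hBΘ : B ⊆ Θ) (hΘ : volume Θ ≠ ∞)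
    (hle : volume Θ ≤ volume B) (g : Param d → ℝ) :
    ∫ x, g x ∂playMeasure Θ (fun _ => 1) = ⨍ x in B, g x := by
  have hae : B =ᵐ[volume] Θ :=
    ae_eq_of_subset_of_measure_ge hBΘ hle hBm.nullMeasurableSet hΘ
  rw [integral_playMeasure ⟨measurable_const, fun _ => le_rfl, 1, one_pos, fun _ => le_rfl⟩,
    setAverage_congr hae, setAverage_eq]
  simp [density, integral_const_mul, Measure.real]

lemma integral_plays_le {lam K : ℝ} {T : ℕ} {ℓ : ℕ → Ω → Param d → ℝ}
    {A : ℕ → Ω → Fin M → Set (Param d)}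
    (hℓm : ∀ t, Measurable fun q : Ω × Param d => ℓ t q.1 q.2)
    (hℓ : ∀ t ω, ∀ x ∈ Θ, ℓ t ω x ∈ Set.Icc (0 : ℝ) 1)
    (hA : ∀ t ω, IsFeedbackSystem Θ (A t ω))
    (hAm : ∀ t i, MeasurableSet {q : Ω × Param d | q.2 ∈ A t q.1 i})
    [∀ t, IsMarkovKernel (playKernel lam Θ ℓ A t)] (hBm : MeasurableSet B) (hBΘ : B ⊆ Θ)
    (hB : volume B ≠ 0) (hΘm : MeasurableSet Θ) (hΘ : volume Θ ≠ ∞) (hT : 0 < T)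
    (hlam : lam = Real.sqrt (K / (T * M)))
    (hK : Real.log (volume.real Θ / volume.real B) ≤ K) (ω : Ω) :
    ∫ h, ∑ i : Fin T, ℓ i ω (h i) ∂histKernel (playKernel lam Θ ℓ A) T ω ≤
      (∑ t ∈ Finset.range T, ⨍ x in B, ℓ t ω x) + 3 / 2 * Real.sqrt (K * (T * M)) := by
  have hlam0 : 0 ≤ lam := hlam ▸ Real.sqrt_nonneg _
  have hℓω : ∀ t, Measurable (ℓ t ω) := fun t => (hℓm t).of_uncurry_left
  have hAω : ∀ t i, MeasurableSet (A t ω i) := fun t i => measurable_prodMk_left (hAm t i)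
  have hB' : volume B ≠ ∞ := ((measure_mono hBΘ).trans_lt hΘ.lt_top).ne
  have hvB : 0 < volume.real B := ENNReal.toReal_pos hB hB'
  have hvBΘ : volume.real B ≤ volume.real Θ := measureReal_mono hBΘ hΘ
  have hvΘ : 0 < volume.real Θ := hvB.trans_le hvBΘ
  have hK0 : 0 ≤ K := (Real.log_nonneg ((one_le_div hvB).2 hvBΘ)).trans hK
  have hM : 0 < M := by
    obtain ⟨x, hx⟩ := nonempty_of_measure_ne_zero hB
    have hx' := hBΘ hx
    rw [← (hA 0 ω).2] at hx'
    obtain ⟨i, -⟩ := Set.mem_iUnion.1 hx'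
    exact i.pos
  have hTM : (0 : ℝ) < T * M := by positivity
  have hκ : ∀ t q, ∀ᵐ x ∂playKernel lam Θ ℓ A t q, x ∈ Θ := fun t q => by
    rw [playKernel_apply lam hℓm hAm]
    exact ae_mem_playMeasure hΘm _
  have havg : ∀ t, 0 ≤ ⨍ x in B, ℓ t ω x := fun t => by
    rw [setAverage_eq]
    exact smul_nonneg (by positivity)
      (setIntegral_nonneg hBm fun x hx => (hℓ t ω x (hBΘ hx)).1)
  have hw := isWeight_weight hlam0 hℓω (fun t => hℓ t ω) (fun t => hA t ω) hAω
  rcases hlam0.eq_or_lt with h0 | hpos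
  -- With `lam = 0` the potential cannot be divided by `lam`. But then `K ≤ 0`, so `B` fills `Θ`
  -- almost everywhere, and constant weights already attain the average loss on `B`.
  · have hKle : K ≤ 0 := by
      by_contra! hcon
      have : 0 < lam := hlam ▸ Real.sqrt_pos.2 (by positivity)
      exact this.ne h0
    have hvle : volume Θ ≤ volume B := by
      have h1 : volume.real Θ / volume.real B ≤ 1 := by
        by_contra! hcon
        exact absurd (Real.log_pos hcon) (hK.trans hKle).not_gt
      have h2 := (div_le_one hvB).1 h1
      exact (ENNReal.toReal_le_toReal hΘ hB').1 h2
    have := integral_histKernel_le (D := fun _ _ => 0) (k := 0)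
      (b := fun t => ⨍ x in B, ℓ t ω x) hΘm hκ ω hℓω (fun t => hℓ t ω) havg
      (fun _ => le_rfl) (fun _ _ => by simp) (fun t h => by
        have hmem := hκ t (ω, h)
        refine ⟨?_, ?_⟩
        · simp only [add_zero]
          refine Integrable.of_bound (hℓω t).aestronglyMeasurable 1 (hmem.mono fun x hx => ?_)
          rw [Real.norm_eq_abs, abs_of_nonneg (hℓ t ω x hx).1]
          exact (hℓ t ω x hx).2
        · rw [playKernel_apply lam hℓm hAm, ← h0]
          have hw1 : weight 0 Θ (fun s => ℓ s ω) (fun s => A s ω) t h = fun _ => 1 :=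
            funext fun x => weight_zero_step _ _ t h x
          simp only [hw1, add_zero, zero_add]
          exact (integral_playMeasure_one_eq hBm hBΘ hΘ hvle _).le) T
    have hs := Real.sqrt_nonneg (K * (T * M))
    linarith
  · have hstep := fun t (h : Fin t → Param d) => integral_loss_add_potential_le (B := B)
      (hw t h) (hA t ω) (hAω t) (hℓω t) (hℓ t ω) hpos hBm hBΘ hB hΘm hΘ
    have := integral_histKernel_le (k := K / lam)
      (D := fun t h => potential Θ B (weight lam Θ (fun s => ℓ s ω) (fun s => A s ω) t h) / lam)
      (b := fun t => lam * M / 2 + ⨍ x in B, ℓ t ω x) hΘm hκ ω hℓω (fun t => hℓ t ω)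
      (fun t => add_nonneg (by positivity) (havg t))
      (fun h => by
        have hz : weight lam Θ (fun s => ℓ s ω) (fun s => A s ω) 0 h = fun _ => 1 := rfl
        rw [hz]
        simp [potential, average_eq, hvΘ.ne'])
      (fun t h => by
        rw [← neg_div]
        exact div_le_div_of_nonneg_right
          ((neg_le_neg hK).trans (le_potential (hw t h) hBΘ hB hΘ)) hpos.le)
      (fun t h => by
        rw [playKernel_apply lam hℓm hAm]
        simpa only [weight, Fin.init_snoc, Fin.snoc_last] using hstep t h) T
    -- The step size makes `K / lam = lam * T * M`, twice the accumulated `T * (lam * M / 2)`;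
    -- together they give the factor `3 / 2`.
    have hsq : K = lam ^ 2 * (T * M) := by
      rw [hlam, Real.sq_sqrt (by positivity)]
      field_simp
    have hsqrt : Real.sqrt (K * (T * M)) = lam * (T * M) := by
      rw [hsq, show lam ^ 2 * (T * M) * (T * M) = (lam * (T * M)) ^ 2 by ring]
      exact Real.sqrt_sq (by positivity)
    have hdiv : K / lam = lam * (T * M) := by
      rw [hsq]
      field_simp
    rw [Finset.sum_add_distrib, Finset.sum_const, Finset.card_range, nsmul_eq_mul, hdiv] at this
    rw [hsqrt]
    linarith

/-- On the ball a Lipschitz loss exceeds its central value by at most `L * r`; any other loss does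
so by at most 1, as values lie in `[0, 1]`. -/
lemma average_ball_le {L : ℝ≥0} {r : ℝ} (hr : 0 < r) {x : Param d} (hx : Metric.ball x r ⊆ Θ)
    {ℓ : ℕ → Param d → ℝ} (hℓm : ∀ t, Measurable (ℓ t))
    (hℓ : ∀ t, ∀ y ∈ Θ, ℓ t y ∈ Set.Icc (0 : ℝ) 1) (T : ℕ) :
    ∑ t ∈ Finset.range T, ⨍ y in Metric.ball x r, ℓ t y ≤
      ∑ t ∈ Finset.range T, ℓ t x + T * L * r + nonLipschitzCount L Θ ℓ T r x := by
  classical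
  have hxΘ : x ∈ Θ := hx (Metric.mem_ball_self hr)
  have hcount : (nonLipschitzCount L Θ ℓ T r x : ℝ) = ∑ t ∈ Finset.range T,
      if LipschitzOnWith L (ℓ t) (Metric.ball x r ∩ Θ) then (0 : ℝ) else 1 := by
    have hset : {t : ℕ | t < T ∧ ¬ LipschitzOnWith L (ℓ t) (Metric.ball x r ∩ Θ)} =
        ((Finset.range T).filter fun t => ¬ LipschitzOnWith L (ℓ t) (Metric.ball x r ∩ Θ) :
          Finset ℕ) := by
      ext t
      simp
    rw [nonLipschitzCount, hset, Set.ncard_coe_finset, Finset.card_filter]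
    push_cast
    exact Finset.sum_congr rfl fun t _ => by split_ifs <;> simp_all
  have hone : ∀ t, ⨍ y in Metric.ball x r, ℓ t y ≤ ℓ t x + L * r +
      if LipschitzOnWith L (ℓ t) (Metric.ball x r ∩ Θ) then (0 : ℝ) else 1 := by
    intro t
    set u := ℓ t x + L * r + if LipschitzOnWith L (ℓ t) (Metric.ball x r ∩ Θ) then (0 : ℝ) else 1
      with hu
    have hle : ∀ y ∈ Metric.ball x r, ℓ t y ≤ u := by
      intro y hy
      by_cases hlip : LipschitzOnWith L (ℓ t) (Metric.ball x r ∩ Θ)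
      · have h1 := hlip.dist_le_mul y ⟨hy, hx hy⟩ x ⟨Metric.mem_ball_self hr, hxΘ⟩
        have h2 : (L : ℝ) * dist y x ≤ L * r :=
          mul_le_mul_of_nonneg_left (Metric.mem_ball.1 hy).le L.coe_nonneg
        have h3 := le_abs_self (ℓ t y - ℓ t x)
        rw [← Real.dist_eq] at h3
        rw [hu, if_pos hlip]
        linarith
      · have h1 := (hℓ t x hxΘ).1
        have h2 := (hℓ t y (hx hy)).2
        have h3 : 0 ≤ (L : ℝ) * r := by positivity
        rw [hu, if_neg hlip]
        linarith
    have hvol : volume.real (Metric.ball x r) ≠ 0 :=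
      (ENNReal.toReal_pos (Metric.measure_ball_pos _ _ hr).ne' measure_ball_lt_top.ne).ne'
    have hi : IntegrableOn (ℓ t) (Metric.ball x r) := by
      refine Measure.integrableOn_of_bounded measure_ball_lt_top.ne
        (hℓm t).aestronglyMeasurable (M := 1) ?_
      filter_upwards [ae_restrict_mem measurableSet_ball] with y hy
      rw [Real.norm_eq_abs, abs_of_nonneg (hℓ t y (hx hy)).1]
      exact (hℓ t y (hx hy)).2
    have hmono : ∫ y in Metric.ball x r, ℓ t y ≤ ∫ _ in Metric.ball x r, u :=
      setIntegral_mono_on hi (integrableOn_const measure_ball_lt_top.ne) measurableSet_ball hle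
    rw [setIntegral_const, smul_eq_mul] at hmono
    rw [setAverage_eq, smul_eq_mul]
    calc (volume.real (Metric.ball x r))⁻¹ * ∫ y in Metric.ball x r, ℓ t y
        ≤ (volume.real (Metric.ball x r))⁻¹ * (volume.real (Metric.ball x r) * u) :=
          mul_le_mul_of_nonneg_left hmono (by positivity)
      _ = u := by rw [← mul_assoc, inv_mul_cancel₀ hvol, one_mul]
  rw [hcount]
  refine (Finset.sum_le_sum fun t _ => hone t).trans_eq ?_
  rw [Finset.sum_add_distrib, Finset.sum_add_distrib, Finset.sum_const, Finset.card_range,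
    nsmul_eq_mul, mul_assoc]

lemma log_volume_ratio_le {c x : Param d} {R r : ℝ} (hr : 0 < r)
    (hΘ : Θ ⊆ Metric.closedBall c R) (hx : Metric.ball x r ⊆ Θ) :
    Real.log (volume.real Θ / volume.real (Metric.ball x r)) ≤ d * Real.log (R / r) := by
  have hR : 0 ≤ R := dist_nonneg.trans (hΘ (hx (Metric.mem_ball_self hr)))
  have hle : volume.real Θ ≤ volume.real (Metric.closedBall c R) :=
    measureReal_mono hΘ measure_closedBall_lt_top.ne
  have hu : 0 < volume.real (Metric.ball (0 : Param d) 1) :=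
    ENNReal.toReal_pos (Metric.measure_ball_pos _ _ one_pos).ne' measure_ball_lt_top.ne
  have hBr : volume.real (Metric.ball x r) = r ^ d * volume.real (Metric.ball (0 : Param d) 1) := by
    rw [Measure.real, Measure.addHaar_ball_of_pos _ _ hr, ENNReal.toReal_mul,
      ENNReal.toReal_ofReal (by positivity), finrank_euclideanSpace_fin, Measure.real]
  have hcR : volume.real (Metric.closedBall c R) =
      R ^ d * volume.real (Metric.ball (0 : Param d) 1) := by
    rw [Measure.real, Measure.addHaar_closedBall _ _ hR, ENNReal.toReal_mul,
      ENNReal.toReal_ofReal (by positivity), finrank_euclideanSpace_fin, Measure.real]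
  have hB : 0 < volume.real (Metric.ball x r) := by rw [hBr]; positivity
  have hΘfin : volume Θ ≠ ∞ := ((measure_mono hΘ).trans_lt measure_closedBall_lt_top).ne
  have hvΘ : 0 < volume.real Θ := hB.trans_le (measureReal_mono hx hΘfin)
  rw [← Real.log_pow]
  refine Real.log_le_log (by positivity) ?_
  rw [div_le_iff₀ hB, hBr]
  refine (hle.trans_eq hcR).trans_eq ?_
  rw [div_pow]
  field_simp

end Regret

end Exp3Set

/-! ### Averaging the regret over the adversary's randomness -/

theorem mainTheorem1 :
    ∃ C : ℝ, 0 < C ∧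
      ∀ (d M : ℕ) (Θ : Set (Exp3Set.Param d)) (c : Exp3Set.Param d) (R : ℝ) (L : ℝ≥0)
        (r₀ r : ℝ) (f : ℕ → ℝ → ℝ) (T : ℕ)
        (Ω : Type*) [MeasurableSpace Ω] (P : Measure Ω) [IsProbabilityMeasure P]
        (ℓ : ℕ → Ω → Exp3Set.Param d → ℝ) (A : ℕ → Ω → Fin M → Set (Exp3Set.Param d))
        (ρstar : Ω → Exp3Set.Param d),
        -- the parameter space
        MeasurableSet Θ → Θ ⊆ Metric.closedBall c R →
        -- the losses
        (∀ t, Measurable fun q : Ω × Exp3Set.Param d => ℓ t q.1 q.2) →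
        (∀ t ω, ∀ x ∈ Θ, ℓ t ω x ∈ Set.Icc (0 : ℝ) 1) →
        (∀ t ω, Exp3Set.PiecewiseLipschitz L Θ (ℓ t ω)) →
        Exp3Set.Dispersed P L Θ ℓ f →
        Exp3Set.HasInteriorMinimizer P Θ ℓ r₀ →
        -- the feedback systems
        (∀ t ω, Exp3Set.IsFeedbackSystem Θ (A t ω)) →
        (∀ t i, MeasurableSet {q : Ω × Exp3Set.Param d | q.2 ∈ A t q.1 i}) →
        -- the radius and the horizon
        0 < r → r ≤ r₀ → 0 < T →
        -- the best parameter in hindsight, with a measurable total loss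
        (∀ᵐ ω ∂P, Exp3Set.IsBestInHindsight Θ (fun t => ℓ t ω) T (ρstar ω)) →
        AEMeasurable (fun ω => ∑ t : Fin T, ℓ t ω (ρstar ω)) P →
        Integrable
            (fun q : Ω × (Fin T → Exp3Set.Param d) =>
              ∑ t : Fin T, (ℓ t q.1 (q.2 t) - ℓ t q.1 (ρstar q.1)))
            (Exp3Set.runLaw P (Real.sqrt (d * Real.log (R / r) / (T * M))) Θ ℓ A T) ∧
          ∫ q : Ω × (Fin T → Exp3Set.Param d),
              ∑ t : Fin T, (ℓ t q.1 (q.2 t) - ℓ t q.1 (ρstar q.1))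
              ∂(Exp3Set.runLaw P (Real.sqrt (d * Real.log (R / r) / (T * M))) Θ ℓ A T) ≤
            C * (Real.sqrt (d * T * M * Real.log (R / r)) + f T r + T * L * r) := by
  refine ⟨3 / 2, by norm_num, ?_⟩
  intro d M Θ c R L r₀ r f T Ω _ P _ ℓ A ρstar hΘm hΘ hℓm hℓ _ hdisp hmin hA hAm hr hrr hT hbest
    hVm
  set lam := Real.sqrt (d * Real.log (R / r) / (T * M)) with hlam
  have hΘfin : volume Θ ≠ ∞ := ((measure_mono hΘ).trans_lt measure_closedBall_lt_top).ne
  have hΘpos : volume Θ ≠ 0 := by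
    obtain ⟨ω, hω⟩ := hmin.exists
    obtain ⟨x, -, hx⟩ := hω T
    exact ((Metric.measure_ball_pos volume x (hr.trans_le hrr)).trans_le (measure_mono hx)).ne'
  have hfinΘ : IsFiniteMeasure (volume.restrict Θ) := ⟨by simpa using hΘfin.lt_top⟩
  have hneΘ : NeZero (volume.restrict Θ) := ⟨by simpa using hΘpos⟩
  have hmarkov : ∀ t, IsMarkovKernel (Exp3Set.playKernel lam Θ ℓ A t) :=
    Exp3Set.isMarkovKernel_playKernel (Real.sqrt_nonneg _) hℓm hℓ hA hAm
  have hplay : ∀ t q, ∀ᵐ x ∂Exp3Set.playKernel lam Θ ℓ A t q, x ∈ Θ := fun t q => by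
    rw [Exp3Set.playKernel_apply lam hℓm hAm]
    exact Exp3Set.ae_mem_playMeasure hΘm _
  have hhist := Exp3Set.ae_mem_histKernel (Exp3Set.playKernel lam Θ ℓ A) hΘm hplay T
  rw [Exp3Set.runLaw_eq_compProd]
  set η := Exp3Set.histKernel (Exp3Set.playKernel lam Θ ℓ A) T with hη
  set F := fun q : Ω × (Fin T → Exp3Set.Param d) =>
    ∑ t : Fin T, (ℓ t q.1 (q.2 t) - ℓ t q.1 (ρstar q.1)) with hF
  have hfst : (P ⊗ₘ η).map Prod.fst = P := Measure.fst_compProd P η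
  have hFbound : ∀ ω h, (∀ i, h i ∈ Θ) → ρstar ω ∈ Θ → ‖F (ω, h)‖ ≤ T := by
    intro ω h hh hρ
    refine (norm_sum_le _ _).trans ((Finset.sum_le_sum (g := fun _ => (1 : ℝ)) fun t _ => ?_).trans
      (by simp))
    have h1 := hℓ t ω _ (hh t)
    have h2 := hℓ t ω _ hρ
    rw [Real.norm_eq_abs, abs_le]
    constructor <;> linarith [h1.1, h1.2, h2.1, h2.2]
  have hFm : AEMeasurable F (P ⊗ₘ η) := by
    have h1 : Measurable fun q : Ω × (Fin T → Exp3Set.Param d) =>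
        ∑ t : Fin T, ℓ t q.1 (q.2 t) :=
      Finset.measurable_sum _ fun t _ => (hℓm t).comp
        (measurable_fst.prodMk ((measurable_pi_apply t).comp measurable_snd))
    have h2 : AEMeasurable (fun q : Ω × (Fin T → Exp3Set.Param d) =>
        ∑ t : Fin T, ℓ t q.1 (ρstar q.1)) (P ⊗ₘ η) := by
      rw [← hfst] at hVm
      exact hVm.comp_measurable measurable_fst
    simp only [hF, Finset.sum_sub_distrib]
    exact h1.aemeasurable.sub h2
  have hFi : Integrable F (P ⊗ₘ η) := by
    refine Integrable.of_bound hFm.aestronglyMeasurable T ?_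
    have hset : MeasurableSet {q : Ω × (Fin T → Exp3Set.Param d) | ∀ i, q.2 i ∈ Θ} := by
      simp only [Set.ofPred_forall]
      exact MeasurableSet.iInter fun i => ((measurable_pi_apply i).comp measurable_snd) hΘm
    have h1 : ∀ᵐ q ∂P ⊗ₘ η, ∀ i, q.2 i ∈ Θ :=
      Measure.ae_compProd_of_ae_ae hset (ae_of_all _ hhist)
    have h2 : ∀ᵐ q ∂P ⊗ₘ η, Exp3Set.IsBestInHindsight Θ (fun t => ℓ t q.1) T (ρstar q.1) := by
      rw [← hfst] at hbest
      exact ae_of_ae_map measurable_fst.aemeasurable hbest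
    filter_upwards [h1, h2] with q hq1 hq2 using hFbound q.1 q.2 hq1 hq2.1
  refine ⟨hFi, ?_⟩
  set b := 3 / 2 * Real.sqrt (d * T * M * Real.log (R / r)) + T * L * r with hb
  set N := fun ω => ⨆ x ∈ Θ,
    (Exp3Set.nonLipschitzCount L Θ (fun t => ℓ t ω) T r x : ℝ≥0∞) with hN
  -- `N` is a supremum over possibly uncountably many points, with no measurability established. The
  -- comparison is therefore made between nonnegative extended reals, under the lower integral.
  have hregret : ∀ᵐ ω ∂P, ENNReal.ofReal ((∫ h, F (ω, h) ∂η ω) - b) ≤ N ω := by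
    filter_upwards [hmin, hbest] with ω hω hρ
    obtain ⟨x, hxbest, hx⟩ := hω T
    have hxr : Metric.ball x r ⊆ Θ := (Metric.ball_subset_ball hrr).trans hx
    have hplays := Exp3Set.integral_plays_le (T := T) (K := d * Real.log (R / r)) hℓm hℓ hA hAm
      measurableSet_ball hxr (Metric.measure_ball_pos volume x hr).ne' hΘm hΘfin hT hlam
      (Exp3Set.log_volume_ratio_le hr hΘ hxr) ω
    have hball := Exp3Set.average_ball_le (L := L) hr hxr (ℓ := fun t => ℓ t ω)
      (fun t => (hℓm t).of_uncurry_left) (fun t => hℓ t ω) T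
    have hsub : ∫ h, F (ω, h) ∂η ω =
        (∫ h, ∑ t : Fin T, ℓ t ω (h t) ∂η ω) - ∑ t ∈ Finset.range T, ℓ t ω (ρstar ω) := by
      have hi : Integrable (fun h : Fin T → Exp3Set.Param d => ∑ t : Fin T, ℓ t ω (h t)) (η ω) := by
        refine integrable_finsetSum _ fun t _ => Integrable.of_bound
          ((hℓm t).of_uncurry_left.comp (measurable_pi_apply t)).aestronglyMeasurable 1 ?_
        filter_upwards [hhist ω] with h hh
        rw [Real.norm_eq_abs, abs_of_nonneg (hℓ t ω _ (hh t)).1]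
        exact (hℓ t ω _ (hh t)).2
      simp only [hF, Finset.sum_sub_distrib]
      rw [integral_sub hi (integrable_const _), integral_const, probReal_univ, one_smul,
        Finset.sum_range]
    have hle : (∫ h, F (ω, h) ∂η ω) - b ≤
        Exp3Set.nonLipschitzCount L Θ (fun t => ℓ t ω) T r x := by
      -- `ρstar ω` need not be interior, but its total loss is at least that of the minimizer `x`,
      -- so regret against it is no larger.
      have h1 := hxbest.2 _ hρ.1
      have h2 : (d : ℝ) * Real.log (R / r) * (T * M) = d * T * M * Real.log (R / r) := by ring
      rw [h2] at hplays
      rw [hsub, hb]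
      linarith
    calc ENNReal.ofReal ((∫ h, F (ω, h) ∂η ω) - b)
        ≤ ENNReal.ofReal (Exp3Set.nonLipschitzCount L Θ (fun t => ℓ t ω) T r x) :=
          ENNReal.ofReal_le_ofReal hle
      _ = Exp3Set.nonLipschitzCount L Θ (fun t => ℓ t ω) T r x := ENNReal.ofReal_natCast _
      _ ≤ N ω := le_iSup₂_of_le x hxbest.1 le_rfl
  have hNfin : ∫⁻ ω, N ω ∂P ≠ ∞ := by
    have hle : ∀ ω, N ω ≤ T := fun ω => iSup₂_le fun x _ => by
      have h1 : Exp3Set.nonLipschitzCount L Θ (fun t => ℓ t ω) T r x ≤ (Set.Iio T).ncard :=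
        Set.ncard_le_ncard (fun t ht => ht.1) (Set.finite_Iio T)
      rw [← Finset.coe_Iio, Set.ncard_coe_finset, Nat.card_Iio] at h1
      exact_mod_cast h1
    refine ((lintegral_mono hle).trans_lt ?_).ne
    simp
  have hGi : Integrable (fun ω => ∫ h, F (ω, h) ∂η ω) P :=
    Integrable.integral_compProd (κ := Kernel.const Unit P) (η := Kernel.prodMkLeft Unit η)
      (a := ()) hFi
  have hGb : Integrable (fun ω => (∫ h, F (ω, h) ∂η ω) - b) P := hGi.sub (integrable_const _)
  have hupper : ∫ ω, ((∫ h, F (ω, h) ∂η ω) - b) ∂P ≤ f T r := by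
    -- Dropping the negative part leaves the lower integral that dispersion controls.
    rw [integral_eq_lintegral_pos_part_sub_lintegral_neg_part hGb]
    refine (sub_le_self _ ENNReal.toReal_nonneg).trans (le_trans ?_ (hdisp T r hr))
    exact ENNReal.toReal_mono hNfin (lintegral_mono_ae hregret)
  rw [integral_sub hGi (integrable_const _), integral_const, probReal_univ, one_smul] at hupper
  rw [Measure.integral_compProd hFi]
  -- The last two terms are obtained with coefficient 1; their nonnegativity allows the common
  -- constant `3 / 2`.
  have hf : 0 ≤ f T r := ENNReal.toReal_nonneg.trans (hdisp T r hr)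
  have hL : 0 ≤ (T : ℝ) * L * r := by positivity
  linarith
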